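/- A commutative ring $A$ with unity is a *pm-ring* if every prime ideal of $A$ is contained in a unique maximal ideal. Let $\mathrm{Spec}(A)$ and its subspace $\mathrm{Max}(A)$ of maximal ideals carry the Zariski topology. For a pm-ring $A$, the map $\mu:\mathrm{Spec}(A)\to\mathrm{Max}(A)$ sending a prime ideal to the unique maximal ideal containing it is continuous. Let $k$ be $\mathbb{Z}$ or $\mathbb{R}$, and let $A$ be a pm-ring that is a $k$-algebra. For a unital $k$-algebra endomorphism $f$ of $A$, let $\mu_f:\mathrm{Max}(A)\to\mathrm{Max}(A)$ be the continuous map $M\mapsto\mu(f^{-1}(M))$. Let $$X_k^A=\{\mu_f : f \text{ a unital } k\text{-algebra endomorphism of } A\}\subseteq C(\mathrm{Max}(A),\mathrm{Max}(A))$$ carry the subspace topology of the compact-open topology, and put $\pi_k^{alg}(A)=\pi_1(X_k^A,\mu_{id_A})$. For a topological space $X$, let $C(X)$ be the ring of continuous functions $X\to\mathbb{R}$ and $C^*(X)$ the ring of bounded ones; both are $\mathbb{R}$-algebras and pm-rings. **Theorem.** For every topological space $X$ there is a Tychonoff (completely regular Hausdorff) space $Y$, with Stone–Čech compactification $\beta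 Y$, such that there are group isomorphisms $$\pi_{\mathbb{R}}^{alg}(C^*(X))\;\cong\;\pi_{\mathbb{Z}}^{alg}(C^*(X))\;\cong\;\pi_1\big(C(\beta Y,\beta Y),\,id_{\beta Y}\big),$$ where $C(\beta Y,\beta Y)$ carries the compact-open topology. Moreover, for this $Y$ and $A=C(\beta Y)$, there is a homeomorphism $X_{\mathbb{Z}}^{A}\to C(\beta Y,\beta Y)$ taking $\mu_{id_A}$ to $id_{\beta Y}$. -/

import Mathlib

universe u

open scoped BoundedContinuousFunction

/-- A commutative ring is a pm-ring if every prime ideal lies in exactly one maximal ideal. -/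
class IsPMRing (A : Type*) [CommRing A] : Prop where
  existsUnique_le : ∀ P : PrimeSpectrum A, ∃! M : MaximalSpectrum A, P.asIdeal ≤ M.asIdeal

/-- The retraction `Spec A → Max A` of a pm-ring: it sends a prime ideal to the unique maximal
ideal containing it. -/
noncomputable def pmRetraction (A : Type*) [CommRing A] [IsPMRing A] (P : PrimeSpectrum A) :
    MaximalSpectrum A :=
  (IsPMRing.existsUnique_le P).choose

theorem le_pmRetraction {A : Type*} [CommRing A] [IsPMRing A] (P : PrimeSpectrum A) :
    P.asIdeal ≤ (pmRetraction A P).asIdeal :=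
  (IsPMRing.existsUnique_le P).choose_spec.1

theorem eq_pmRetraction {A : Type*} [CommRing A] [IsPMRing A] {P : PrimeSpectrum A}
    {M : MaximalSpectrum A} (h : P.asIdeal ≤ M.asIdeal) : M = pmRetraction A P :=
  (IsPMRing.existsUnique_le P).choose_spec.2 M h

/-- For the Zariski topologies, the retraction `Spec A → Max A` of a pm-ring is continuous. -/
theorem continuous_pmRetraction (A : Type*) [CommRing A] [IsPMRing A] :
    Continuous (pmRetraction A) := by
  rw [continuous_iff_isClosed]
  intro F hF
  obtain ⟨Z, hZ, rfl⟩ := isClosed_induced_iff.mp hF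
  obtain ⟨I, rfl⟩ := (PrimeSpectrum.isClosed_iff_zeroLocus_ideal Z).mp hZ
  set s : Set (PrimeSpectrum A) := pmRetraction A ⁻¹'
    (MaximalSpectrum.toPrimeSpectrum ⁻¹' PrimeSpectrum.zeroLocus (I : Set A)) with hs
  have mem_s : ∀ P : PrimeSpectrum A, P ∈ s ↔ I ≤ (pmRetraction A P).asIdeal := fun _ => Iff.rfl
  rw [← closure_subset_iff_isClosed, ← PrimeSpectrum.zeroLocus_vanishingIdeal_eq_closure]
  intro Q hQ
  rw [PrimeSpectrum.mem_zeroLocus, SetLike.coe_subset_coe] at hQ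
  -- the multiplicative set of all `q * t` with `q ∉ Q` and `t ∈ 1 + I`
  let T : Submonoid A :=
    { carrier := {t | t - 1 ∈ I}
      one_mem' := by simp
      mul_mem' := by
        intro a b ha hb
        have : a * b - 1 = a * (b - 1) + (a - 1) := by ring
        change a * b - 1 ∈ I
        rw [this]
        exact I.add_mem (I.mul_mem_left _ hb) ha }
  have hdisj : Disjoint ((⊥ : Ideal A) : Set A) ((Q.asIdeal.primeCompl ⊔ T : Submonoid A) : Set A) := by
    rw [Set.disjoint_left]
    intro x hx hxS
    obtain ⟨q, hq, t, ht, rfl⟩ := Submonoid.mem_sup.mp hxS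
    have h0 : q * t = 0 := by simpa using hx
    refine hq (hQ ((PrimeSpectrum.mem_vanishingIdeal _ _).mpr fun P hP => ?_))
    have : q * t ∈ P.asIdeal := by rw [h0]; exact P.asIdeal.zero_mem
    refine (P.isPrime.mem_or_mem this).resolve_right fun htP => ?_
    have h1 : t - 1 ∈ (pmRetraction A P).asIdeal := (mem_s P).mp hP ht
    have h2 : t ∈ (pmRetraction A P).asIdeal := le_pmRetraction P htP
    refine (pmRetraction A P).isMaximal.ne_top ((Ideal.eq_top_iff_one _).mpr ?_)
    have := Ideal.sub_mem _ h2 h1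
    simpa using this
  obtain ⟨P, hP, -, hPS⟩ := Ideal.exists_le_prime_disjoint _ _ hdisj
  rw [Set.disjoint_left] at hPS
  have hPQ : P ≤ Q.asIdeal := fun x hx => by
    by_contra hxQ
    exact hPS hx (Submonoid.mem_sup_left hxQ)
  have hPI : P ⊔ I ≠ ⊤ := fun h => by
    obtain ⟨p, hp, i, hi, hpi⟩ := Submodule.mem_sup.mp ((Ideal.eq_top_iff_one _).mp h)
    refine hPS hp (Submonoid.mem_sup_right ?_)
    change p - 1 ∈ I
    rw [← hpi]
    simpa using hi
  obtain ⟨M, hM, hle⟩ := Ideal.exists_le_maximal _ hPI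
  have e1 : (⟨M, hM⟩ : MaximalSpectrum A) = pmRetraction A ⟨P, hP⟩ :=
    eq_pmRetraction (P := ⟨P, hP⟩) (le_sup_left.trans hle)
  have e2 : pmRetraction A Q = pmRetraction A ⟨P, hP⟩ :=
    eq_pmRetraction (P := ⟨P, hP⟩) (hPQ.trans (le_pmRetraction Q))
  rw [mem_s, e2, ← e1]
  exact le_sup_right.trans hle

/-- The map `μ_f : Max A → Max A` induced by an endomorphism `f` of the `k`-algebra `A`: the
retraction `Spec A → Max A` applied to the preimage of a maximal ideal under `f`. -/
noncomputable def inducedSpectralMap {k A : Type*} [CommRing k] [CommRing A] [Algebra k A]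
    [IsPMRing A] (f : A →ₐ[k] A) : C(MaximalSpectrum A, MaximalSpectrum A) where
  toFun M := pmRetraction A (PrimeSpectrum.comap (f : A →+* A) M.toPrimeSpectrum)
  continuous_toFun := (continuous_pmRetraction A).comp
    ((PrimeSpectrum.continuous_comap (f : A →+* A)).comp
      MaximalSpectrum.toPrimeSpectrum_continuous)

/-- The space of induced spectral maps of the `k`-algebra `A`, with the subspace topology of the
compact-open topology on `C(Max A, Max A)`. -/
abbrev InducedSpectralMaps (k A : Type*) [CommRing k] [CommRing A] [Algebra k A] [IsPMRing A] :
    Type _ :=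
  Set.range (inducedSpectralMap : (A →ₐ[k] A) → C(MaximalSpectrum A, MaximalSpectrum A))

/-- The map induced by the identity of `A`, as a point of the space of induced spectral maps. -/
noncomputable def inducedSpectralId (k A : Type*) [CommRing k] [CommRing A] [Algebra k A]
    [IsPMRing A] : InducedSpectralMaps k A :=
  ⟨inducedSpectralMap (AlgHom.id k A), AlgHom.id k A, rfl⟩

/-- The spectral fundamental group of the `k`-algebra `A`. -/
abbrev SpectralFundamentalGroup (k A : Type*) [CommRing k] [CommRing A] [Algebra k A]
    [IsPMRing A] : Type _ :=
  FundamentalGroup (InducedSpectralMaps k A) (inducedSpectralId k A)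

/-- A commutative ring is a pm-ring as soon as `a + b = 1` always gives `r`, `s` with
`(1 - a r) (1 - b s) = 0`. -/
theorem IsPMRing.of_forall_add_eq_one {A : Type*} [CommRing A]
    (h : ∀ a b : A, a + b = 1 → ∃ r s : A, (1 - a * r) * (1 - b * s) = 0) : IsPMRing A where
  existsUnique_le P := by
    have key : ∀ (M : MaximalSpectrum A) (a r : A), P.asIdeal ≤ M.asIdeal → a ∈ M.asIdeal →
        1 - a * r ∉ P.asIdeal := fun M a r hPM ha hr => by
      refine M.isMaximal.ne_top ((Ideal.eq_top_iff_one _).mpr ?_)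
      have := M.asIdeal.add_mem (hPM hr) (M.asIdeal.mul_mem_right r ha)
      simpa using this
    obtain ⟨M, hM, hPM⟩ := Ideal.exists_le_maximal P.asIdeal P.isPrime.ne_top
    refine ⟨⟨M, hM⟩, hPM, fun N hPN => ?_⟩
    by_contra hne
    have hne' : N.asIdeal ≠ M := fun e => hne (MaximalSpectrum.ext e)
    have htop : N.asIdeal ⊔ M = ⊤ := Ideal.IsMaximal.coprime_of_ne N.isMaximal hM hne'
    obtain ⟨a, ha, b, hb, hab⟩ := Submodule.mem_sup.mp ((Ideal.eq_top_iff_one _).mp htop)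
    obtain ⟨r, s, hrs⟩ := h a b hab
    have h0 : (1 - a * r) * (1 - b * s) ∈ P.asIdeal := by rw [hrs]; exact P.asIdeal.zero_mem
    rcases P.isPrime.mem_or_mem h0 with h1 | h1
    · exact key N a r hPN ha h1
    · exact key ⟨M, hM⟩ b s hPM hb h1

theorem one_sub_mul_inv_max_eq_zero {a b : ℝ} (h : a + b = 1) :
    (1 - a * (max a 2⁻¹)⁻¹) * (1 - b * (max b 2⁻¹)⁻¹) = 0 := by
  have aux : ∀ c : ℝ, 2⁻¹ ≤ c → 1 - c * (max c 2⁻¹)⁻¹ = 0 := fun c hc => by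
    have : c ≠ 0 := by intro h0; norm_num [h0] at hc
    rw [max_eq_left hc, mul_inv_cancel₀ this, sub_self]
  rcases le_total 2⁻¹ a with ha | ha
  · rw [aux a ha, zero_mul]
  · rw [aux b (by norm_num at ha ⊢; linarith), mul_zero]

theorem continuous_inv_max {X : Type*} [TopologicalSpace X] {a : X → ℝ} (ha : Continuous a) :
    Continuous fun x => (max (a x) 2⁻¹)⁻¹ :=
  (ha.max continuous_const).inv₀ fun x =>
    (lt_of_lt_of_le (by norm_num : (0 : ℝ) < 2⁻¹) (le_max_right _ _)).ne'

/-- The ring of continuous real-valued functions on a topological space is a pm-ring. -/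
instance ContinuousMap.instIsPMRing (X : Type*) [TopologicalSpace X] : IsPMRing C(X, ℝ) :=
  .of_forall_add_eq_one fun a b hab =>
    ⟨⟨_, continuous_inv_max a.continuous⟩, ⟨_, continuous_inv_max b.continuous⟩, by
      ext x
      exact one_sub_mul_inv_max_eq_zero (DFunLike.congr_fun hab x)⟩

/-- The ring of bounded continuous real-valued functions on a topological space is a pm-ring. -/
instance BoundedContinuousFunction.instIsPMRing (X : Type*) [TopologicalSpace X] :
    IsPMRing (X →ᵇ ℝ) :=
  .of_forall_add_eq_one fun a b hab => by
    have bound : ∀ c : ℝ, ‖(max c 2⁻¹)⁻¹‖ ≤ 2 := fun c => by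
      have h : (2⁻¹ : ℝ) ≤ max c 2⁻¹ := le_max_right _ _
      rw [Real.norm_of_nonneg (inv_nonneg.mpr (le_trans (by norm_num) h))]
      exact inv_le_of_inv_le₀ (by norm_num) h
    refine ⟨.ofNormedAddCommGroup _ (continuous_inv_max a.continuous) 2 fun x => bound (a x),
      .ofNormedAddCommGroup _ (continuous_inv_max b.continuous) 2 fun x => bound (b x), ?_⟩
    ext x
    exact one_sub_mul_inv_max_eq_zero (DFunLike.congr_fun hab x)

/-!
The point is that for a real algebra `A` isomorphic to `C(K, ℝ)` with `K` compact Hausdorff, every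
continuous self-map of `Max A` is induced by an algebra endomorphism, so that the space of induced
spectral maps is all of `C(Max A, Max A)`, over whichever base ring the endomorphisms are taken.

Sending a point `x` to the maximal ideal of the elements that vanish at `x` is a homeomorphism
`K ≃ₜ Max A` for the Zariski topology (`maximalSpectrumHomeomorph`): it is onto because a proper
ideal of `C(K, ℝ)` has a common zero, and it is closed because the continuous functions separate
points from closed sets. Under this homeomorphism, a continuous `h : K → K` is the map induced by
the composition operator `a ↦ a ∘ h` (`inducedSpectralMap_compEnd`). Composition operators are
`ℝ`-linear, hence also `ℤ`-linear, and so conjugation by the homeomorphism identifies the induced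
spectral maps over `ℝ` and over `ℤ` alike with `C(K, K)`, the identity corresponding to the
identity (`inducedSpectralMapsHomeomorph`). Fundamental groups are invariant under pointed
homeomorphisms.

It remains to write the ring of bounded continuous functions on `X` as `C(βY, ℝ)` for a Tychonoff
space `Y`. The space `Y` is the image of `X` in its Stone–Čech compactification, which is the
Tychonoff reflection of `X`: a bounded continuous function on `X` extends to `βX`, restricts to `Y`
and extends again to `βY` (`boundedContinuousFunctionEquiv`).
-/

open Topology

/-! ### Fundamental groups of homeomorphic spaces -/

namespace FundamentalGroup

theorem mapOfEq_mapOfEq_of_leftInverse {S T : Type*} [TopologicalSpace S] [TopologicalSpace T]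
    {s : S} {t : T} (f : C(S, T)) (g : C(T, S)) (hf : f s = t) (hg : g t = s)
    (hgf : Function.LeftInverse g f) (p : FundamentalGroup S s) :
    mapOfEq g hg (mapOfEq f hf p) = p := by
  subst hf
  rw [mapOfEq_apply, mapOfEq_apply]
  induction p using Path.Homotopic.Quotient.ind with
  | mk γ =>
    refine congrArg Path.Homotopic.Quotient.mk (Path.ext (funext fun r => ?_))
    exact hgf (γ r)

/-- The isomorphism of fundamental groups given by a homeomorphism that respects base points. -/
noncomputable def mulEquivOfHomeomorph {S T : Type*} [TopologicalSpace S] [TopologicalSpace T]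
    {s : S} {t : T} (φ : S ≃ₜ T) (h : φ s = t) : FundamentalGroup S s ≃* FundamentalGroup T t :=
  have h' : φ.symm t = s := by rw [← h, φ.symm_apply_apply]
  { mapOfEq (φ : C(S, T)) h with
    invFun := mapOfEq (φ.symm : C(T, S)) h'
    left_inv := mapOfEq_mapOfEq_of_leftInverse _ _ h h' φ.symm_apply_apply
    right_inv := mapOfEq_mapOfEq_of_leftInverse _ _ h' h φ.apply_symm_apply }

end FundamentalGroup

/-! ### The maximal spectrum of a ring of continuous functions -/

section MaximalSpectrum

variable {K A : Type*} [TopologicalSpace K] [CommRing A] [Algebra ℝ A] (e : A ≃ₐ[ℝ] C(K, ℝ))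

/-- The maximal ideal of the elements of `A` that vanish at the point `x`, where `A` is regarded
as the ring `C(K, ℝ)` through the isomorphism `e`. -/
def vanishingMaximalIdeal (x : K) : MaximalSpectrum A where
  asIdeal := RingHom.ker ((ContinuousMap.evalAlgHom ℝ ℝ x).comp (e : A →ₐ[ℝ] C(K, ℝ)))
  isMaximal := RingHom.ker_isMaximal_of_surjective _ fun r =>
    ⟨e.symm (ContinuousMap.const K r), by simp⟩

theorem mem_vanishingMaximalIdeal {x : K} {a : A} :
    a ∈ (vanishingMaximalIdeal e x).asIdeal ↔ e a x = 0 :=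
  Iff.rfl

/-- The preimage of a Zariski closed set is a zero set. -/
theorem continuous_vanishingMaximalIdeal : Continuous (vanishingMaximalIdeal e) := by
  rw [continuous_iff_isClosed]
  intro F hF
  obtain ⟨Z, hZ, rfl⟩ := isClosed_induced_iff.mp hF
  obtain ⟨s, rfl⟩ := (PrimeSpectrum.isClosed_iff_zeroLocus Z).mp hZ
  have : vanishingMaximalIdeal e ⁻¹' (MaximalSpectrum.toPrimeSpectrum ⁻¹'
      PrimeSpectrum.zeroLocus s) = ⋂ a ∈ s, {x | e a x = 0} := by
    ext x
    simp only [Set.mem_iInter]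
    exact Iff.rfl
  rw [this]
  exact isClosed_biInter fun a _ => isClosed_eq (e a).continuous continuous_const

variable [CompactSpace K] [T2Space K]

theorem exists_vanishing_on_isClosed {F : Set K} (hF : IsClosed F) {x : K} (hx : x ∉ F) :
    ∃ a : A, (∀ y ∈ F, e a y = 0) ∧ e a x ≠ 0 := by
  obtain ⟨f, hf0, hf1, -⟩ := exists_continuous_zero_one_of_isClosed hF
    (isClosed_singleton (x := x)) (Set.disjoint_singleton_right.mpr hx)
  refine ⟨e.symm f, fun y hy => ?_, ?_⟩
  · simpa using hf0 hy
  · simp [hf1 rfl]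

theorem vanishingMaximalIdeal_injective : Function.Injective (vanishingMaximalIdeal e) := by
  intro x y hxy
  by_contra hne
  obtain ⟨a, ha, ha'⟩ := exists_vanishing_on_isClosed e (isClosed_singleton (x := y))
    (x := x) hne
  have : a ∈ (vanishingMaximalIdeal e x).asIdeal := hxy ▸ ha y rfl
  exact ha' this

theorem vanishingMaximalIdeal_surjective : Function.Surjective (vanishingMaximalIdeal e) := by
  intro M
  have hM : (M.asIdeal.comap e.symm).IsMaximal :=
    Ideal.comap_isMaximal_of_equiv e.symm
  obtain ⟨x, hx⟩ := ContinuousMap.setOfIdeal_eq_compl_singleton (M.asIdeal.comap e.symm)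
  have hx' : x ∉ ContinuousMap.setOfIdeal (M.asIdeal.comap e.symm) := by simp [hx]
  refine ⟨x, MaximalSpectrum.ext (M.isMaximal.eq_of_le
    (vanishingMaximalIdeal e x).isMaximal.ne_top fun a ha => ?_).symm⟩
  refine ContinuousMap.notMem_setOfIdeal.mp hx' (f := e a) ?_
  rw [Ideal.mem_comap, e.symm_apply_apply]
  exact ha

/-- The image of a closed set is the zero locus of the ideal of functions vanishing on it. -/
theorem isClosedMap_vanishingMaximalIdeal : IsClosedMap (vanishingMaximalIdeal e) := by
  intro F hF
  refine isClosed_induced_iff.mpr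
    ⟨PrimeSpectrum.zeroLocus {a : A | ∀ y ∈ F, e a y = 0}, PrimeSpectrum.isClosed_zeroLocus _, ?_⟩
  ext M
  obtain ⟨x, rfl⟩ := vanishingMaximalIdeal_surjective e M
  rw [(vanishingMaximalIdeal_injective e).mem_set_image]
  constructor
  · intro h
    by_contra hx
    obtain ⟨a, ha, ha'⟩ := exists_vanishing_on_isClosed e hF hx
    exact ha' (h ha)
  · exact fun hx a ha => ha x hx

/-- A compact Hausdorff space `K` is homeomorphic to the maximal spectrum of `C(K, ℝ)` with its
Zariski topology. -/
noncomputable def maximalSpectrumHomeomorph : K ≃ₜ MaximalSpectrum A :=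
  (Equiv.ofBijective _ ⟨vanishingMaximalIdeal_injective e,
    vanishingMaximalIdeal_surjective e⟩).toHomeomorphOfIsInducing
    (IsClosedEmbedding.of_continuous_injective_isClosedMap (continuous_vanishingMaximalIdeal e)
      (vanishingMaximalIdeal_injective e) (isClosedMap_vanishingMaximalIdeal e)).isInducing

theorem maximalSpectrumHomeomorph_apply (x : K) :
    maximalSpectrumHomeomorph e x = vanishingMaximalIdeal e x :=
  rfl

end MaximalSpectrum

/-! ### Induced spectral maps of a ring of continuous functions -/

theorem inducedSpectralMap_id (k A : Type*) [CommRing k] [CommRing A] [Algebra k A] [IsPMRing A] :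
    inducedSpectralMap (AlgHom.id k A) = ContinuousMap.id (MaximalSpectrum A) :=
  ContinuousMap.ext fun _ => (eq_pmRetraction le_rfl).symm

section InducedSpectralMaps

variable {K A : Type*} [TopologicalSpace K] [CommRing A] [Algebra ℝ A] (e : A ≃ₐ[ℝ] C(K, ℝ))
  (k : Type*) [CommRing k] [Algebra k A] [Algebra k ℝ] [IsScalarTower k ℝ A]

/-- The composition operator `a ↦ a ∘ h` on `A ≃ C(K, ℝ)`, as an endomorphism of `k`-algebras. -/
noncomputable def compEnd (h : C(K, K)) : A →ₐ[k] A :=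
  AlgHom.restrictScalars k
    ((e.symm : C(K, ℝ) →ₐ[ℝ] A).comp ((ContinuousMap.compRightAlgHom ℝ ℝ h).comp
      (e : A →ₐ[ℝ] C(K, ℝ))))

theorem apply_compEnd (h : C(K, K)) (a : A) (x : K) : e (compEnd e k h a) x = e a (h x) := by
  simp [compEnd]

theorem inducedSpectralMap_compEnd [IsPMRing A] (h : C(K, K)) (x : K) :
    inducedSpectralMap (compEnd e k h) (vanishingMaximalIdeal e x) =
      vanishingMaximalIdeal e (h x) := by
  refine (eq_pmRetraction fun a ha => ?_).symm
  rw [mem_vanishingMaximalIdeal, ← apply_compEnd e k]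
  exact ha

variable [CompactSpace K] [T2Space K] [IsPMRing A]

include e in
theorem range_inducedSpectralMap :
    Set.range (inducedSpectralMap : (A →ₐ[k] A) → C(MaximalSpectrum A, MaximalSpectrum A)) =
      Set.univ := by
  refine Set.eq_univ_of_forall fun g => ?_
  let φ := maximalSpectrumHomeomorph e
  refine ⟨compEnd e k ((φ.symm : C(_, _)).comp (g.comp (φ : C(_, _)))),
    ContinuousMap.ext fun M => ?_⟩
  obtain ⟨x, rfl⟩ := φ.surjective M
  exact (inducedSpectralMap_compEnd e k _ x).trans (φ.apply_symm_apply _)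

/-- The space of induced spectral maps of `A ≃ C(K, ℝ)` over any base ring is homeomorphic to the
space of continuous self-maps of `K`, by conjugation with the homeomorphism `K ≃ₜ Max A`. -/
noncomputable def inducedSpectralMapsHomeomorph : InducedSpectralMaps k A ≃ₜ C(K, K) :=
  ((Homeomorph.setCongr (range_inducedSpectralMap e k)).trans (Homeomorph.Set.univ _)).trans
    ((maximalSpectrumHomeomorph e).symm.arrowCongr (maximalSpectrumHomeomorph e).symm)

theorem inducedSpectralMapsHomeomorph_id :
    inducedSpectralMapsHomeomorph e k (inducedSpectralId k A) = ContinuousMap.id K := by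
  ext x
  change (maximalSpectrumHomeomorph e).symm
    (inducedSpectralMap (AlgHom.id k A) (maximalSpectrumHomeomorph e x)) = x
  rw [inducedSpectralMap_id, ContinuousMap.id_apply, Homeomorph.symm_apply_apply]

/-- The spectral fundamental group of `A ≃ C(K, ℝ)` over any base ring is the fundamental group of
the space of continuous self-maps of `K`. -/
noncomputable def spectralFundamentalGroupMulEquiv :
    SpectralFundamentalGroup k A ≃* FundamentalGroup C(K, K) (ContinuousMap.id K) :=
  FundamentalGroup.mulEquivOfHomeomorph (inducedSpectralMapsHomeomorph e k)
    (inducedSpectralMapsHomeomorph_id e k)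

end InducedSpectralMaps

/-! ### Bounded continuous functions and the Stone–Čech compactification -/

/-- A bounded continuous real function extends to the Stone–Čech compactification, as it takes
values in a compact interval. -/
theorem exists_stoneCech_extension {X : Type*} [TopologicalSpace X] (f : X →ᵇ ℝ) :
    ∃ F : C(StoneCech X, ℝ), ∀ x, F (stoneCechUnit x) = f x := by
  let g : X → Metric.closedBall (0 : ℝ) ‖f‖ := fun x =>
    ⟨f x, mem_closedBall_zero_iff.mpr (f.norm_coe_le_norm x)⟩
  have hg : Continuous g := f.continuous.subtype_mk _
  exact ⟨⟨fun z => (stoneCechExtend hg z).val,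
    continuous_subtype_val.comp (continuous_stoneCechExtend hg)⟩,
    fun x => congrArg Subtype.val (stoneCechExtend_stoneCechUnit hg x)⟩

/-- The Tychonoff reflection of a space, encoded as its image in the Stone–Čech
compactification. -/
abbrev TychonoffReflection (X : Type u) [TopologicalSpace X] : Type u :=
  Set.range (stoneCechUnit : X → StoneCech X)

/-- The canonical map from `X` to the Stone–Čech compactification of its Tychonoff reflection. -/
def toStoneCechReflection (X : Type*) [TopologicalSpace X] :
    C(X, StoneCech (TychonoffReflection X)) where
  toFun x := stoneCechUnit ⟨stoneCechUnit x, x, rfl⟩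
  continuous_toFun := continuous_stoneCechUnit.comp (continuous_stoneCechUnit.subtype_mk _)

theorem denseRange_toStoneCechReflection (X : Type*) [TopologicalSpace X] :
    DenseRange (toStoneCechReflection X) :=
  denseRange_stoneCechUnit.comp (f := fun x : X => (⟨stoneCechUnit x, x, rfl⟩ :
    TychonoffReflection X)) (Function.Surjective.denseRange (by rintro ⟨_, x, rfl⟩; exact ⟨x, rfl⟩))
    continuous_stoneCechUnit

/-- Restriction of functions along the canonical map from `X` to the Stone–Čech compactification
of its Tychonoff reflection. -/
noncomputable def restrictToBounded (X : Type*) [TopologicalSpace X] :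
    C(StoneCech (TychonoffReflection X), ℝ) →ₐ[ℝ] (X →ᵇ ℝ) where
  toFun F := (BoundedContinuousFunction.mkOfCompact F).compContinuous (toStoneCechReflection X)
  map_one' := rfl
  map_mul' _ _ := rfl
  map_zero' := rfl
  map_add' _ _ := rfl
  commutes' _ := rfl

theorem restrictToBounded_bijective (X : Type*) [TopologicalSpace X] :
    Function.Bijective (restrictToBounded X) := by
  constructor
  · intro F G h
    refine DFunLike.coe_injective ((denseRange_toStoneCechReflection X).equalizer F.continuous
      G.continuous (funext fun x => ?_))
    exact DFunLike.congr_fun h x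
  · intro f
    obtain ⟨F, hF⟩ := exists_stoneCech_extension f
    obtain ⟨G, hG⟩ := exists_stoneCech_extension
      ((BoundedContinuousFunction.mkOfCompact F).compContinuous
        (⟨Subtype.val, continuous_subtype_val⟩ : C(TychonoffReflection X, StoneCech X)))
    exact ⟨G, BoundedContinuousFunction.ext fun x => (hG _).trans (hF x)⟩

/-- The algebra of bounded continuous real functions on `X` is the algebra of all continuous real
functions on the Stone–Čech compactification of the Tychonoff reflection of `X`. -/
noncomputable def boundedContinuousFunctionEquiv (X : Type*) [TopologicalSpace X] :
    (X →ᵇ ℝ) ≃ₐ[ℝ] C(StoneCech (TychonoffReflection X), ℝ) :=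
  (AlgEquiv.ofBijective (restrictToBounded X) (restrictToBounded_bijective X)).symm

theorem theorem4p6 (X : Type u) [TopologicalSpace X] :
    ∃ (Y : Type u) (_ : TopologicalSpace Y), T35Space Y ∧
      Nonempty (SpectralFundamentalGroup ℝ (X →ᵇ ℝ) ≃* SpectralFundamentalGroup ℤ (X →ᵇ ℝ)) ∧
      Nonempty (SpectralFundamentalGroup ℤ (X →ᵇ ℝ) ≃*
        FundamentalGroup C(StoneCech Y, StoneCech Y) (ContinuousMap.id (StoneCech Y))) ∧
      ∃ χ : InducedSpectralMaps ℤ C(StoneCech Y, ℝ) ≃ₜ C(StoneCech Y, StoneCech Y),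
        χ (inducedSpectralId ℤ C(StoneCech Y, ℝ)) = ContinuousMap.id (StoneCech Y) := by
  let e := boundedContinuousFunctionEquiv X
  exact ⟨TychonoffReflection X, inferInstance, inferInstance,
    ⟨(spectralFundamentalGroupMulEquiv e ℝ).trans (spectralFundamentalGroupMulEquiv e ℤ).symm⟩,
    ⟨spectralFundamentalGroupMulEquiv e ℤ⟩,
    inducedSpectralMapsHomeomorph AlgEquiv.refl ℤ, inducedSpectralMapsHomeomorph_id _ ℤ⟩
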